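/- Let $D=\{z\in\mathbb{C}:|z|<1\}$, let $n$ be a positive integer, let $0<p\le 1$, and let $A\in C^\infty(\overline{D})$ be complex-valued. Let $f:D\to\mathbb{C}$ belong to the meta-Hardy space $H^{n,p}_A(D)$, that is, $f$ satisfies \[ \left(\frac{\partial}{\partial\bar z}-A\right)^n f=0 \quad\text{in } D \] in the classical sense (each of the $n$ successive applications of $\frac{\partial}{\partial\bar z}-A$ is made to a function that is real differentiable at every point of $D$), and \[ \sum_{k=0}^{n-1}\left(\sup_{0<r<1}\int_0^{2\pi}\left|\frac{\partial^k f}{\partial\bar z^k}(re^{i\theta})\right|^p d\theta\right)^{1/p}<\infty . \] Then $f$ has a boundary value in the sense of distributions: there is a distribution $f_b\in\mathcal{D}'(\partial D)$ (a continuous linear functional on the space $C^\infty(\partial D)$ of smooth complex-valued $2\pi$-periodic functions of $\theta$) such that, for every $\varphi\in C^\infty(\partial D)$, \[ \lim_{r\nearrow 1}\int_0^{2\pi} f(re^{i\theta})\,\varphi(\theta)\,d\theta=\langle f_b,\varphi\rangle ; \] in particular the limit exists. -/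

import Mathlib

open scoped ContDiff

/-- The open unit disk `D` in the complex plane. -/
def unitDisk : Set ℂ := Metric.ball 0 1

/-- The Wirtinger derivative `∂f/∂z̄ = (1/2) (∂f/∂x + i ∂f/∂y)`. -/
noncomputable def dbar (f : ℂ → ℂ) (z : ℂ) : ℂ :=
  (1 / 2 : ℂ) * (fderiv ℝ f z 1 + Complex.I * fderiv ℝ f z Complex.I)

/-- The operator `f ↦ (∂/∂z̄ - A) f`. -/
noncomputable def metaOp (A f : ℂ → ℂ) (z : ℂ) : ℂ :=
  dbar f z - A z * f z

/-- `f` solves `(∂/∂z̄ - A)^n f = 0` on `D`. Each of the `n` successive applications of the operator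
is made to a function that is real differentiable at every point of `D`. -/
def IsMetaAnalytic (n : ℕ) (A f : ℂ → ℂ) : Prop :=
  (∀ k < n, DifferentiableOn ℝ ((metaOp A)^[k] f) unitDisk) ∧
    ∀ z ∈ unitDisk, (metaOp A)^[n] f z = 0

/-- `∑_{k < n} (sup_{0 < r < 1} ∫_0^{2π} |(∂^k f/∂z̄^k)(r e^{iθ})|^p dθ)^{1/p}`, as an element of
`[0, ∞]`. -/
noncomputable def hardyNorm (n : ℕ) (p : ℝ) (f : ℂ → ℂ) : ENNReal :=
  ∑ k ∈ Finset.range n,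
    (⨆ r ∈ Set.Ioo (0 : ℝ) 1,
      ∫⁻ θ in Set.Ioc 0 (2 * Real.pi), ‖dbar^[k] f (circleMap 0 r θ)‖ₑ ^ p) ^ (1 / p)

/-- The meta-Hardy space `H^{n,p}_A(D)`, for a coefficient `A` that is smooth in `D`. A function on
`D` is represented by a function on `ℂ`, of which only the values on `D` matter. For smooth `A`
a solution of the equation is automatically smooth in `D`, so the iterated derivatives in the norm
exist in the classical sense. -/
def MetaHardy (n : ℕ) (p : ℝ) (A : ℂ → ℂ) : Set (ℂ → ℂ) :=
  {f | IsMetaAnalytic n A f ∧ hardyNorm n p f < ⊤}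

/-- The test functions `C^∞(∂D)`: smooth `2π`-periodic functions of the angle. -/
def circleTest : Submodule ℂ (ℝ → ℂ) where
  carrier := {φ | ContDiff ℝ ∞ φ ∧ Function.Periodic φ (2 * Real.pi)}
  add_mem' := fun ha hb => ⟨ha.1.add hb.1, ha.2.add hb.2⟩
  zero_mem' := ⟨contDiff_const, fun _ => rfl⟩
  smul_mem' := fun c _ h => ⟨contDiff_const.smul h.1, h.2.smul c⟩

/-- A linear functional on `C^∞(∂D)` is a distribution if it is continuous, that is, bounded by a
multiple of the `C^N` norm for some `N`. -/
def IsCircleDistribution (u : circleTest →ₗ[ℂ] ℂ) : Prop :=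
  ∃ (N : ℕ) (C : ℝ), ∀ (φ : circleTest) (M : ℝ),
    (∀ j ≤ N, ∀ θ : ℝ, ‖iteratedDeriv j (φ : ℝ → ℂ) θ‖ ≤ M) → ‖u φ‖ ≤ C * M

/-- `f` has a boundary value `f_b ∈ 𝒟'(∂D)` in the sense of distributions:
`⟨f_b, φ⟩ = lim_{r ↗ 1} ∫_0^{2π} f(r e^{iθ}) φ(θ) dθ` for every `φ ∈ C^∞(∂D)`. The integrals are
required to make sense for `r` close to `1`. -/
def HasDistributionalBoundaryValue (f : ℂ → ℂ) : Prop :=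
  (∀ᶠ r in nhdsWithin (1 : ℝ) (Set.Iio 1),
    IntervalIntegrable (fun θ : ℝ => f (circleMap 0 r θ)) MeasureTheory.volume
      0 (2 * Real.pi)) ∧
  ∃ u : circleTest →ₗ[ℂ] ℂ, IsCircleDistribution u ∧
    ∀ φ : circleTest,
      Filter.Tendsto
        (fun r : ℝ => ∫ θ in (0 : ℝ)..(2 * Real.pi), f (circleMap 0 r θ) * (φ : ℝ → ℂ) θ)
        (nhdsWithin 1 (Set.Iio 1)) (nhds (u φ))

/-! The functions `G k = dbar^[k] f`, `k < n`, solve a linear system `∂G/∂z̄ = a G` whose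
coefficients are smooth up to the boundary: expand `(∂/∂z̄ - A)^n` and solve for the top derivative.
For such systems two facts give the theorem.

Polynomial growth (`IsApproxSubmean.exists_growth`). Put `V = ∑ |G k|`. Since `|∂G/∂z̄|` is at most
a multiple of `V`, Green's formula gives `V` the sub-mean value inequality on circles up to an error
linear in the radius. The Hardy bounds make `V ^ p` integrable over the disk. As `p ≤ 1`, Jensen's
inequality does not help; instead one maximises `V z * (R - |z|) ^ (2 / p)` over a disc of radius `R
< 1`. Near a maximum point `V` is at most twice its value there, so the error is absorbed on a small
disc and `V` can be replaced by `V ^ p`.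

Descent (`HasGrowthBound.improve`). With `r = e ^ s`, Green's formula reads `d/ds ⟨H, φ⟩ = 2 ⟨w̄
∂H/∂z̄, φ⟩ + i ⟨H, φ'⟩`. For `H = G k * g` with `g` smooth up to the boundary, the right side pairs
functions that are sums of the same kind with `φ` or `φ'`. If all such pairings are `O((-s) ^ (-(σ +
1)))`, then integration in `s` gives `O((-s) ^ (-σ))`, at the price of one more derivative of `φ`.
Finitely many rounds reach the exponent `1 / 2`. The `s`-derivative is then integrable up to `s =
0`, so the limit exists and is controlled by a `C^N` norm of `φ`. -/

/-- The integral of `H` against a function of the angle over the circle with centre `c` and radius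
`e ^ s`. -/
noncomputable def circlePairing (c : ℂ) (H : ℂ → ℂ) (φ : ℝ → ℂ) (s : ℝ) : ℂ :=
  ∫ θ in (0 : ℝ)..(2 * Real.pi), H (c + Complex.exp (s + θ * Complex.I)) * φ θ

/-! ### Green's formula in logarithmic polar coordinates -/

section Green

open Complex MeasureTheory Set intervalIntegral
open scoped Interval

lemma norm_exp_add_mul_I (s θ : ℝ) : ‖exp (s + θ * I)‖ = Real.exp s := by
  simp [Complex.norm_exp]

/-- The combination `L v + I * L (I * v)` annihilates the complex linear part of a real linear map
`L` and doubles the antilinear part, whose coefficient is `dbar H z`. -/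
lemma fderiv_add_I_mul_fderiv (H : ℂ → ℂ) (z v : ℂ) :
    fderiv ℝ H z v + I * fderiv ℝ H z (I * v) = 2 * (starRingEnd ℂ v * dbar H z) := by
  have key : ∀ u : ℂ, fderiv ℝ H z u = u.re * fderiv ℝ H z 1 + u.im * fderiv ℝ H z I := by
    intro u
    conv_lhs => rw [← Complex.re_add_im u]
    rw [map_add]
    have h1 : (u.re : ℂ) = u.re • (1 : ℂ) := by simp
    have h2 : (u.im : ℂ) * I = u.im • I := by simp
    rw [h2, h1, map_smul, map_smul]
    simp
  rw [key v, key (I * v), dbar]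
  have hc : starRingEnd ℂ v = v.re - v.im * I := by
    apply Complex.ext <;> simp
  rw [hc]
  simp only [Complex.mul_re, Complex.mul_im, I_re, I_im]
  push_cast
  ring_nf
  simp only [I_sq]
  ring

/-- Chain and product rule in the coordinate `ζ = s + iθ`, where circles become vertical segments.
The left side is the integrand of the real Green formula on a rectangle. -/
theorem dbar_comp_exp_mul {c ζ : ℂ} {H : ℂ → ℂ} {φ : ℝ → ℂ}
    (hH : DifferentiableAt ℝ H (c + exp ζ)) (hφ : DifferentiableAt ℝ φ ζ.im) :
    DifferentiableAt ℝ (fun ζ => H (c + exp ζ) * φ ζ.im) ζ ∧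
      I • fderiv ℝ (fun ζ => H (c + exp ζ) * φ ζ.im) ζ 1 -
        fderiv ℝ (fun ζ => H (c + exp ζ) * φ ζ.im) ζ I =
      I * (2 * (starRingEnd ℂ (exp ζ) * dbar H (c + exp ζ) * φ ζ.im) +
        I * (H (c + exp ζ) * deriv φ ζ.im)) := by
  have h1 : HasFDerivAt (fun ζ : ℂ => c + exp ζ) _ ζ :=
    (((Complex.hasDerivAt_exp ζ).const_add c).hasFDerivAt).restrictScalars ℝ
  have h2 := hH.hasFDerivAt.comp ζ h1
  have h3 : HasFDerivAt (fun ζ : ℂ => φ ζ.im) _ ζ :=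
    hφ.hasDerivAt.hasFDerivAt.comp ζ Complex.imCLM.hasFDerivAt
  have h4 := h2.mul h3
  refine ⟨h4.differentiableAt, ?_⟩
  have h5 : fderiv ℝ (fun ζ => H (c + exp ζ) * φ ζ.im) ζ = _ := h4.fderiv
  rw [h5]
  have h6 := fderiv_add_I_mul_fderiv H (c + exp ζ) (exp ζ)
  simp only [add_apply, smul_apply,
    ContinuousLinearMap.comp_apply, ContinuousLinearMap.coe_restrictScalars', Function.comp,
    ContinuousLinearMap.toSpanSingleton_apply, smul_eq_mul, one_mul, Complex.imCLM_apply, one_im,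
    I_im, one_smul, zero_smul, mul_zero, zero_add]
  linear_combination (I * φ ζ.im) * h6 +
    (-(H (c + exp ζ) * deriv φ ζ.im) - φ ζ.im * fderiv ℝ H (c + exp ζ) (I * exp ζ)) * I_sq

lemma circlePairing_integrand_continuous {c : ℂ} {R s : ℝ} {H : ℂ → ℂ} {φ : ℝ → ℂ}
    (hH : ContinuousOn H (Metric.ball c R)) (hφ : Continuous φ) (hs : Real.exp s < R) :
    Continuous fun θ : ℝ => H (c + exp (s + θ * I)) * φ θ := by
  refine Continuous.mul ?_ hφ
  refine hH.comp_continuous (by fun_prop) fun θ => ?_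
  simpa [norm_exp_add_mul_I] using hs

/-- Green's formula on an annulus, against a function of the angle. -/
theorem circlePairing_sub {c : ℂ} {R a b : ℝ} {H : ℂ → ℂ} {φ : ℝ → ℂ}
    (hH : DifferentiableOn ℝ H (Metric.ball c R)) (hH' : ContinuousOn (dbar H) (Metric.ball c R))
    (hφ : ContDiff ℝ 1 φ) (hper : Function.Periodic φ (2 * Real.pi)) (hab : a ≤ b)
    (hb : Real.exp b < R) :
    circlePairing c H φ b - circlePairing c H φ a =
      ∫ s in a..b, (2 * circlePairing c (fun w => starRingEnd ℂ (w - c) * dbar H w) φ s +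
        I * circlePairing c H (deriv φ) s) := by
  have hφd : Differentiable ℝ φ := hφ.differentiable (by norm_num)
  have hφ' : Continuous (deriv φ) := hφ.continuous_deriv (by norm_num)
  have hmem : ∀ ζ ∈ [[a, b]] ×ℂ [[0, 2 * Real.pi]], c + exp ζ ∈ Metric.ball c R := by
    intro ζ hζ
    have h1 : ζ.re ≤ b := by
      have := hζ.1
      rw [mem_preimage, uIcc_of_le hab] at this
      exact this.2
    simp only [Metric.mem_ball, dist_eq_norm, add_sub_cancel_left, Complex.norm_exp]
    exact (Real.exp_le_exp.2 h1).trans_lt hb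
  have hd : ∀ ζ ∈ [[a, b]] ×ℂ [[0, 2 * Real.pi]], _ := fun ζ hζ =>
    dbar_comp_exp_mul (φ := φ) (ζ := ζ)
      ((hH _ (hmem ζ hζ)).differentiableAt (Metric.isOpen_ball.mem_nhds (hmem ζ hζ)))
      (hφd ζ.im)
  have hmaps : MapsTo (fun ζ => c + exp ζ) ([[a, b]] ×ℂ [[0, 2 * Real.pi]]) (Metric.ball c R) :=
    hmem
  have hcont : ContinuousOn (fun ζ : ℂ => I * (2 * (starRingEnd ℂ (exp ζ) * dbar H (c + exp ζ) *
      φ ζ.im) + I * (H (c + exp ζ) * deriv φ ζ.im))) ([[a, b]] ×ℂ [[0, 2 * Real.pi]]) := by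
    have e1 := hH'.comp (f := fun ζ => c + exp ζ) (by fun_prop) hmaps
    have e2 := hH.continuousOn.comp (f := fun ζ => c + exp ζ) (by fun_prop) hmaps
    have e3 : Continuous fun ζ : ℂ => starRingEnd ℂ (exp ζ) := by fun_prop
    have e4 : Continuous fun ζ : ℂ => φ ζ.im := hφ.continuous.comp Complex.continuous_im
    have e5 : Continuous fun ζ : ℂ => deriv φ ζ.im := hφ'.comp Complex.continuous_im
    exact continuousOn_const.mul ((continuousOn_const.mul ((e3.continuousOn.mul e1).mul
      e4.continuousOn)).add (continuousOn_const.mul (e2.mul e5.continuousOn)))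
  have hcpt : IsCompact ([[a, b]] ×ℂ [[0, 2 * Real.pi]]) :=
    isCompact_uIcc.reProdIm isCompact_uIcc
  -- The rectangle `[a, b] × [0, 2π]` covers the annulus once; by periodicity its two horizontal
  -- sides cancel (`htop`).
  have hrect := integral_boundary_rect_of_differentiableOn_real
    (fun ζ => H (c + exp ζ) * φ ζ.im) (a : ℂ) (b + (2 * Real.pi : ℝ) * I)
    (by
      intro ζ hζ
      simp only [add_re, ofReal_re, mul_re, I_re, mul_zero, ofReal_im, I_im, mul_one, sub_self,
        add_zero, add_im, mul_im, zero_add] at hζ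
      exact (hd ζ hζ).1.differentiableWithinAt)
    (by
      simp only [add_re, ofReal_re, mul_re, I_re, mul_zero, ofReal_im, I_im, mul_one, sub_self,
        add_zero, add_im, mul_im, zero_add]
      refine (hcont.integrableOn_compact hcpt).congr_fun (fun ζ hζ => ((hd ζ hζ).2).symm) ?_
      exact hcpt.measurableSet)
  simp only [add_re, ofReal_re, mul_re, I_re, mul_zero, ofReal_im, I_im, mul_one, sub_self,
        add_zero, add_im, mul_im, zero_add, ofReal_zero, zero_mul] at hrect
  have htop : ∀ x : ℝ, H (c + exp (x + (2 * Real.pi : ℝ) * I)) * φ (2 * Real.pi) =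
      H (c + exp x) * φ 0 := by
    intro x
    have h1 : φ (2 * Real.pi) = φ 0 := by simpa using hper 0
    have h2 : exp (x + (2 * Real.pi : ℝ) * I) = exp x := by
      rw [exp_add]; push_cast; rw [exp_two_pi_mul_I, mul_one]
    rw [h1, h2]
  simp only [htop, sub_self, zero_add] at hrect
  have hpair : ∀ x : ℝ, (∫ y in (0 : ℝ)..(2 * Real.pi), H (c + exp (x + y * I)) * φ y) =
    circlePairing c H φ x := fun _ => rfl
  simp only [hpair] at hrect
  have hI : I * (circlePairing c H φ b - circlePairing c H φ a) =
      I * ∫ s in a..b, (2 * circlePairing c (fun w => starRingEnd ℂ (w - c) * dbar H w) φ s +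
        I * circlePairing c H (deriv φ) s) := by
    rw [mul_sub, ← smul_eq_mul, ← smul_eq_mul, hrect, ← intervalIntegral.integral_const_mul]
    refine integral_congr fun x hx => ?_
    have hx' := hx
    rw [uIcc_of_le hab] at hx'
    have hxb := (Real.exp_le_exp.2 hx'.2).trans_lt hb
    have hre : ∀ y : ℝ, (x + y * I : ℂ).re = x := by simp
    have him : ∀ y : ℝ, (x + y * I : ℂ).im = y := by simp
    have hc1 := circlePairing_integrand_continuous (s := x)
      (H := fun w => starRingEnd ℂ (w - c) * dbar H w) (φ := φ) (c := c) (R := R)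
      (by refine ContinuousOn.mul ?_ hH'; fun_prop) hφ.continuous hxb
    have hc2 := circlePairing_integrand_continuous (s := x) hH.continuousOn hφ' hxb
    simp only [circlePairing]
    rw [← intervalIntegral.integral_const_mul 2, ← intervalIntegral.integral_const_mul I,
      ← intervalIntegral.integral_add, ← intervalIntegral.integral_const_mul]
    · refine integral_congr fun y hy => ?_
      have hmem' : (x + y * I : ℂ) ∈ [[a, b]] ×ℂ [[0, 2 * Real.pi]] := by
        constructor
        · simpa using hx
        · simpa using hy
      have := (hd _ hmem').2
      simp only [him] at this
      rw [this]
      simp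
    · exact (continuous_const.mul hc1).intervalIntegrable _ _
    · exact (continuous_const.mul hc2).intervalIntegrable _ _
  exact mul_left_cancel₀ I_ne_zero hI

end Green

/-! ### Approximate mean values and polar integration -/

section MeanValue

open Complex MeasureTheory Set intervalIntegral
open scoped Interval

lemma circleMap_eq_exp_log {c : ℂ} {ρ : ℝ} (hρ : 0 < ρ) (θ : ℝ) :
    circleMap c ρ θ = c + exp (Real.log ρ + θ * I) := by
  rw [circleMap, exp_add, ← ofReal_exp, Real.exp_log hρ]

/-- An approximate mean value inequality for functions with bounded Wirtinger derivative. -/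
theorem norm_le_circle_average_add {z : ℂ} {R ρ B : ℝ} {H : ℂ → ℂ}
    (hH : DifferentiableOn ℝ H (Metric.ball z R)) (hH' : ContinuousOn (dbar H) (Metric.ball z R))
    (hρ : 0 < ρ) (hρR : ρ < R) (hB : ∀ w ∈ Metric.closedBall z ρ, ‖dbar H w‖ ≤ B) :
    2 * Real.pi * ‖H z‖ ≤
      (∫ θ in (0 : ℝ)..(2 * Real.pi), ‖H (circleMap z ρ θ)‖) + 4 * Real.pi * ρ * B := by
  have hpi := Real.pi_pos
  have hB0 : 0 ≤ B := (norm_nonneg _).trans (hB z (Metric.mem_closedBall_self hρ.le))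
  refine le_of_forall_pos_le_add fun ε hε => ?_
  have hcont : ContinuousAt H z :=
    hH.continuousOn.continuousAt (Metric.ball_mem_nhds z (hρ.trans hρR))
  obtain ⟨δ, hδ, hδ'⟩ := Metric.continuousAt_iff.1 hcont (ε / (2 * Real.pi)) (by positivity)
  -- Green's formula is applied between the radii `η` and `ρ`; on the small circle `H` differs from
  -- `H z` by at most `ε / (2π)`.
  set η := min ρ (δ / 2) with hη
  have hη0 : 0 < η := lt_min hρ (by positivity)
  have hlog : Real.log η ≤ Real.log ρ := Real.log_le_log hη0 (min_le_left _ _)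
  have hg := circlePairing_sub (φ := fun _ => 1) hH hH' contDiff_const (fun _ => rfl) hlog
    (by rwa [Real.exp_log hρ])
  have hz : circlePairing z H (deriv fun _ => (1 : ℂ)) = fun _ => 0 := by
    funext s; simp [circlePairing]
  rw [hz] at hg
  simp only [mul_zero, add_zero] at hg
  have hbound : ‖circlePairing z H (fun _ => 1) (Real.log ρ) -
      circlePairing z H (fun _ => 1) (Real.log η)‖ ≤ 4 * Real.pi * ρ * B := by
    rw [hg]
    calc _ ≤ ∫ s in Real.log η..Real.log ρ, 4 * Real.pi * B * Real.exp s := by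
          refine norm_integral_le_of_norm_le hlog ?_
            ((Real.continuous_exp.const_mul _).intervalIntegrable _ _)
          refine ae_of_all _ fun s hs => ?_
          have h1 : ‖circlePairing z (fun w => starRingEnd ℂ (w - z) * dbar H w)
              (fun _ => 1) s‖ ≤ Real.exp s * B * |2 * Real.pi - 0| := by
            refine norm_integral_le_of_norm_le_const fun θ _ => ?_
            have h3 : Real.exp s ≤ ρ := by
              rw [← Real.exp_log hρ]; exact Real.exp_le_exp.2 hs.2
            simp only [add_sub_cancel_left, mul_one, norm_mul, RCLike.norm_conj,
              norm_exp_add_mul_I]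
            gcongr
            refine hB _ ?_
            simpa [dist_eq_norm, norm_exp_add_mul_I] using h3
          rw [norm_mul, sub_zero, abs_of_pos (by positivity)] at *
          simp only [Complex.norm_ofNat]
          linarith
      _ = 4 * Real.pi * B * (ρ - η) := by
          rw [intervalIntegral.integral_const_mul, integral_exp, Real.exp_log hρ, Real.exp_log hη0]
      _ ≤ _ := by
          nlinarith [mul_nonneg (mul_nonneg hpi.le hB0) hη0.le]
  have hsmall : ‖circlePairing z H (fun _ => 1) (Real.log η) - 2 * Real.pi * H z‖ ≤ ε := by
    have e1 : circlePairing z H (fun _ => 1) (Real.log η) - 2 * Real.pi * H z =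
        ∫ θ in (0 : ℝ)..(2 * Real.pi), (H (z + exp (Real.log η + θ * I)) * 1 - H z) := by
      rw [intervalIntegral.integral_sub]
      · simp [circlePairing]
      · refine Continuous.intervalIntegrable (circlePairing_integrand_continuous hH.continuousOn
          (φ := fun _ => 1) continuous_const ?_) _ _
        rw [Real.exp_log hη0]
        exact (min_le_left _ _).trans_lt hρR
      · simp
    rw [e1]
    have := norm_integral_le_of_norm_le_const (a := 0) (b := 2 * Real.pi) (C := ε / (2 * Real.pi))
      (f := fun θ : ℝ => H (z + exp (Real.log η + θ * I)) * 1 - H z) fun θ _ => by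
        rw [mul_one, ← dist_eq_norm]
        refine (hδ' ?_).le
        rw [dist_eq_norm, add_sub_cancel_left, norm_exp_add_mul_I, Real.exp_log hη0]
        exact (min_le_right _ _).trans_lt (by linarith)
    rw [sub_zero, abs_of_pos (by positivity : 0 < 2 * Real.pi)] at this
    rwa [div_mul_cancel₀ _ (by positivity)] at this
  have hlast : ‖circlePairing z H (fun _ => 1) (Real.log ρ)‖ ≤
      ∫ θ in (0 : ℝ)..(2 * Real.pi), ‖H (circleMap z ρ θ)‖ := by
    refine (intervalIntegral.norm_integral_le_integral_norm (by positivity)).trans_eq ?_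
    refine integral_congr fun θ _ => ?_
    simp [circleMap_eq_exp_log hρ]
  have h2 : 2 * Real.pi * ‖H z‖ = ‖(2 * Real.pi : ℂ) * H z‖ := by
    simp [abs_of_pos hpi]
  rw [h2]
  have : (2 * Real.pi : ℂ) * H z = circlePairing z H (fun _ => 1) (Real.log ρ) -
    (circlePairing z H (fun _ => 1) (Real.log ρ) - circlePairing z H (fun _ => 1) (Real.log η)) -
    (circlePairing z H (fun _ => 1) (Real.log η) - 2 * Real.pi * H z) := by ring
  rw [this]
  refine (norm_sub_le _ _).trans (add_le_add ((norm_sub_le _ _).trans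
    (add_le_add hlast hbound)) hsmall)

/-- Polar coordinates centred at `c`; periodicity moves the angular range from `(-π, π)` to `(0,
2π]`. -/
theorem lintegral_eq_lintegral_circleMap (c : ℂ) {f : ℂ → ENNReal} (hf : Measurable f) :
    ∫⁻ w, f w = ∫⁻ ρ in Ioi (0 : ℝ), ENNReal.ofReal ρ *
      ∫⁻ θ in Ioc (0 : ℝ) (2 * Real.pi), f (circleMap c ρ θ) := by
  have hcm : ∀ q : ℝ × ℝ, c + Complex.polarCoord.symm q = circleMap c q.1 q.2 := by
    intro q
    rw [Complex.polarCoord_symm_apply, circleMap, exp_mul_I, ofReal_cos, ofReal_sin]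
  rw [← lintegral_add_left_eq_self f c, ← Complex.lintegral_comp_polarCoord_symm,
    polarCoord_target, Measure.volume_eq_prod, ← Measure.prod_restrict, lintegral_prod]
  · refine lintegral_congr fun ρ => ?_
    simp only [hcm, smul_eq_mul]
    rw [lintegral_const_mul _ (by fun_prop)]
    congr 1
    rw [restrict_Ioo_eq_restrict_Ioc]
    have h1 := isAddFundamentalDomain_Ioc Real.two_pi_pos (-Real.pi)
    have h2 := isAddFundamentalDomain_Ioc Real.two_pi_pos 0
    have h3 := h1.setLIntegral_eq h2 (fun θ => f (circleMap c ρ θ)) (by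
      rintro ⟨g, hg⟩ x
      obtain ⟨m, rfl⟩ := AddSubgroup.mem_zmultiples_iff.1 hg
      have hp := (periodic_circleMap c ρ).zsmul m x
      show f (circleMap c ρ (m • (2 * Real.pi) + x)) = _
      rw [add_comm, hp])
    have h4 : -Real.pi + 2 * Real.pi = Real.pi := by ring
    rwa [h4, zero_add] at h3
  · refine Measurable.aemeasurable ?_
    refine Measurable.mul (by fun_prop) (hf.comp ?_)
    simp only [hcm, circleMap]
    fun_prop

end MeanValue

/-! ### From integrability of a power to polynomial growth -/

section Growth

open Complex MeasureTheory Set Filter Topology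

/-- A nonnegative function on the unit disk that satisfies the sub-mean value inequality on circles,
up to an error that is linear in the radius and in a bound for the function. -/
structure IsApproxSubmean (B : ℝ) (V : ℂ → ℝ) : Prop where
  nonneg : ∀ z, 0 ≤ V z
  continuousOn : ContinuousOn V unitDisk
  le_circle_average_add : ∀ (z : ℂ) (ρ T : ℝ), 0 < ρ → ‖z‖ + ρ < 1 →
    (∀ w ∈ Metric.closedBall z ρ, V w ≤ T) →
    2 * Real.pi * V z ≤ (∫ θ in (0 : ℝ)..(2 * Real.pi), V (circleMap z ρ θ)) + ρ * B * T

lemma closedBall_subset_unitDisk {z : ℂ} {δ : ℝ} (h : ‖z‖ + δ < 1) :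
    Metric.closedBall z δ ⊆ unitDisk := by
  intro w hw
  have h1 := mem_closedBall_iff_norm.1 hw
  have h2 := norm_le_norm_add_norm_sub' w z
  simp only [unitDisk, mem_ball_zero_iff]
  linarith

lemma lintegral_Ioo_ofReal {δ : ℝ} (hδ : 0 ≤ δ) :
    ∫⁻ ρ in Ioo (0 : ℝ) δ, ENNReal.ofReal ρ = ENNReal.ofReal (δ ^ 2 / 2) := by
  rw [restrict_Ioo_eq_restrict_Ioc, ← ofReal_integral_eq_lintegral_ofReal,
    ← intervalIntegral.integral_of_le hδ, integral_id]
  · simp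
  · exact (intervalIntegrable_iff_integrableOn_Ioc_of_le hδ).1
      (continuous_id.intervalIntegrable _ _)
  · exact (ae_restrict_iff' measurableSet_Ioc).2 (ae_of_all _ fun x hx => hx.1.le)

/-- Comparison with the area integral of a power `p ≤ 1`, for discs on which the error term can be
absorbed. -/
theorem IsApproxSubmean.mul_sq_le {B p K T δ : ℝ} {V : ℂ → ℝ} {z : ℂ} (hV : IsApproxSubmean B V)
    (hB : 0 ≤ B) (hp1 : p ≤ 1) (hK : 0 ≤ K)
    (hint : ∫⁻ w in unitDisk, ENNReal.ofReal (V w ^ p) ≤ ENNReal.ofReal K)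
    (hδ : 0 < δ) (hz : ‖z‖ + δ < 1) (hT : ∀ w ∈ Metric.closedBall z δ, V w ≤ T)
    (habs : δ * B * T ≤ Real.pi * V z) :
    Real.pi * V z * (δ ^ 2 / 2) ≤ T ^ (1 - p) * K := by
  have hT0 : 0 ≤ T := (hV.nonneg z).trans (hT z (Metric.mem_closedBall_self hδ.le))
  have hsub := closedBall_subset_unitDisk hz
  have hmeas : Measurable ((Metric.ball z δ).indicator fun w => ENNReal.ofReal (V w)) := by
    classical
    have h1 : (Metric.ball z δ).indicator (fun w => ENNReal.ofReal (V w)) =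
        (Metric.ball z δ).piecewise (fun w => ENNReal.ofReal (V w)) (fun _ => 0) := by
      funext w; simp [Set.indicator, Set.piecewise]
    rw [h1]
    refine ContinuousOn.measurable_piecewise ?_ continuousOn_const measurableSet_ball
    exact ENNReal.continuous_ofReal.comp_continuousOn
      (hV.continuousOn.mono (Metric.ball_subset_closedBall.trans hsub))
  have hcirc : ∀ ρ ∈ Ioo (0 : ℝ) δ, ENNReal.ofReal (Real.pi * V z) ≤
      ∫⁻ θ in Ioc (0 : ℝ) (2 * Real.pi),
        (Metric.ball z δ).indicator (fun w => ENNReal.ofReal (V w)) (circleMap z ρ θ) := by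
    intro ρ hρ
    have h1 := hV.le_circle_average_add z ρ T hρ.1 (by linarith [hρ.2])
      fun w hw => hT w (Metric.closedBall_subset_closedBall hρ.2.le hw)
    have hcm : ∀ θ, circleMap z ρ θ ∈ Metric.ball z δ := fun θ => by
      rw [mem_ball_iff_norm, circleMap_sub_center, norm_circleMap_zero, abs_of_pos hρ.1]
      exact hρ.2
    have h2 : δ * B * T ≥ ρ * B * T := by
      have := hρ.2.le
      gcongr
    have hcont : Continuous fun θ => V (circleMap z ρ θ) :=
      hV.continuousOn.comp_continuous (continuous_circleMap z ρ)
        fun θ => hsub (Metric.ball_subset_closedBall (hcm θ))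
    -- By `habs` the error term uses up at most half of `2π V z`.
    have h3 : Real.pi * V z ≤ ∫ θ in (0 : ℝ)..(2 * Real.pi), V (circleMap z ρ θ) := by linarith
    rw [intervalIntegral.integral_of_le Real.two_pi_pos.le] at h3
    refine (ENNReal.ofReal_le_ofReal h3).trans ?_
    rw [ofReal_integral_eq_lintegral_ofReal]
    · refine lintegral_mono fun θ => ?_
      rw [indicator_of_mem (hcm θ)]
    · exact (intervalIntegrable_iff_integrableOn_Ioc_of_le Real.two_pi_pos.le).1
        (hcont.intervalIntegrable _ _)
    · exact ae_of_all _ fun θ => hV.nonneg _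
  have hpow : ∀ w ∈ Metric.ball z δ, V w ≤ T ^ (1 - p) * V w ^ p := by
    intro w hw
    rcases (hV.nonneg w).eq_or_lt with h0 | h0
    · rw [← h0]; positivity
    · calc V w = V w ^ (1 - p) * V w ^ p := by
            rw [← Real.rpow_add h0, sub_add_cancel, Real.rpow_one]
        _ ≤ _ := by
            have := hT w (Metric.ball_subset_closedBall hw)
            have h1p : 0 ≤ 1 - p := by linarith
            gcongr
  rw [← ENNReal.ofReal_le_ofReal_iff (by positivity), ENNReal.ofReal_mul
    (mul_nonneg Real.pi_pos.le (hV.nonneg z)), ← lintegral_Ioo_ofReal hδ.le]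
  calc _ = ∫⁻ ρ in Ioo (0 : ℝ) δ, ENNReal.ofReal ρ * ENNReal.ofReal (Real.pi * V z) := by
        rw [lintegral_mul_const _ (by fun_prop), mul_comm]
    _ ≤ ∫⁻ ρ in Ioo (0 : ℝ) δ, ENNReal.ofReal ρ * ∫⁻ θ in Ioc (0 : ℝ) (2 * Real.pi),
        (Metric.ball z δ).indicator (fun w => ENNReal.ofReal (V w)) (circleMap z ρ θ) :=
        setLIntegral_mono' measurableSet_Ioo fun ρ hρ => mul_le_mul_right (hcirc ρ hρ) _
    _ ≤ ∫⁻ ρ in Ioi (0 : ℝ), ENNReal.ofReal ρ * ∫⁻ θ in Ioc (0 : ℝ) (2 * Real.pi),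
        (Metric.ball z δ).indicator (fun w => ENNReal.ofReal (V w)) (circleMap z ρ θ) :=
        lintegral_mono_set Ioo_subset_Ioi_self
    _ = ∫⁻ w in Metric.ball z δ, ENNReal.ofReal (V w) := by
        rw [← lintegral_eq_lintegral_circleMap z hmeas, lintegral_indicator measurableSet_ball]
    _ ≤ ∫⁻ w in Metric.ball z δ, ENNReal.ofReal (T ^ (1 - p)) * ENNReal.ofReal (V w ^ p) := by
        refine setLIntegral_mono' measurableSet_ball fun w hw => ?_
        rw [← ENNReal.ofReal_mul (by positivity)]
        exact ENNReal.ofReal_le_ofReal (hpow w hw)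
    _ = ENNReal.ofReal (T ^ (1 - p)) * ∫⁻ w in Metric.ball z δ, ENNReal.ofReal (V w ^ p) :=
        lintegral_const_mul' _ _ ENNReal.ofReal_ne_top
    _ ≤ ENNReal.ofReal (T ^ (1 - p)) * ENNReal.ofReal K := by
        refine mul_le_mul_right ((lintegral_mono_set ?_).trans hint) _
        exact Metric.ball_subset_closedBall.trans hsub
    _ = _ := (ENNReal.ofReal_mul (by positivity)).symm

/-- Functions with the approximate sub-mean value property whose `p`-th power is integrable over the
disk grow at most polynomially at the boundary. -/
theorem IsApproxSubmean.exists_growth {B p : ℝ} {V : ℂ → ℝ} (hV : IsApproxSubmean B V)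
    (hB : 0 ≤ B) (hp0 : 0 < p) (hp1 : p ≤ 1)
    (hint : ∫⁻ w in unitDisk, ENNReal.ofReal (V w ^ p) < ⊤) :
    ∃ (m : ℕ) (C : ℝ), 0 ≤ C ∧ ∀ z ∈ unitDisk, V z * (1 - ‖z‖) ^ m ≤ C := by
  obtain ⟨K, hK, hKint⟩ : ∃ K : ℝ, 0 ≤ K ∧
      ∫⁻ w in unitDisk, ENNReal.ofReal (V w ^ p) ≤ ENNReal.ofReal K :=
    ⟨_, ENNReal.toReal_nonneg, (ENNReal.ofReal_toReal hint.ne).ge⟩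
  -- The exponent is chosen so that `(d ^ N) ^ p = d ^ 2`, which matches the area of a disc of
  -- radius comparable to `d`.
  set N : ℝ := 2 / p with hN
  have hN0 : 0 < N := by positivity
  have hNp : N * p = 2 := by rw [hN]; field_simp
  -- The bound on `ε * B` absorbs the error term; the bound on `(1 - ε) ^ N` keeps `V` below twice
  -- its value at the maximum point.
  obtain ⟨ε, hε0, hε1, hεB, hεN⟩ : ∃ ε : ℝ, 0 < ε ∧ ε < 1 ∧ ε * B ≤ 1 ∧ 1 / 2 ≤ (1 - ε) ^ N := by
    have h1 : Tendsto (fun ε : ℝ => ε * B) (𝓝[>] 0) (𝓝 (0 * B)) :=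
      ((continuous_id.mul continuous_const).tendsto 0).mono_left nhdsWithin_le_nhds
    have h2 : Tendsto (fun ε : ℝ => (1 - ε) ^ N) (𝓝[>] 0) (𝓝 ((1 - 0) ^ N)) :=
      Tendsto.mono_left (((continuous_const.sub continuous_id).rpow_const
        fun _ => Or.inr hN0.le).tendsto 0) nhdsWithin_le_nhds
    rw [zero_mul] at h1
    rw [sub_zero, Real.one_rpow] at h2
    have h3 : ∀ᶠ ε : ℝ in 𝓝[>] 0, ε ∈ Ioo (0 : ℝ) 1 := Ioo_mem_nhdsGT one_pos
    obtain ⟨ε, h4, h5, h6⟩ := ((h1.eventually (eventually_le_nhds one_pos)).and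
      ((h2.eventually (eventually_ge_nhds (by norm_num : (1 / 2 : ℝ) < 1))).and h3)).exists
    exact ⟨ε, h6.1, h6.2, h4, h5⟩
  -- A radius `R < 1` guarantees that the maximum is attained; the bound does not depend on `R`.
  have key : ∀ R : ℝ, 0 < R → R < 1 → ∀ z ∈ Metric.closedBall (0 : ℂ) R,
      V z * (R - ‖z‖) ^ N ≤ (2 * K / ε ^ 2) ^ (1 / p) := by
    intro R hR0 hR1
    have hsub : Metric.closedBall (0 : ℂ) R ⊆ unitDisk := closedBall_subset_unitDisk (by simpa)
    obtain ⟨z₀, hz₀, hmax⟩ := (isCompact_closedBall (0 : ℂ) R).exists_isMaxOn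
      (Metric.nonempty_closedBall.2 hR0.le) (f := fun z => V z * (R - ‖z‖) ^ N)
      ((hV.continuousOn.mono hsub).mul (Continuous.continuousOn
        ((continuous_const.sub continuous_norm).rpow_const fun _ => Or.inr hN0.le)))
    intro z hz
    refine (hmax hz).trans ?_
    have hz₀R : ‖z₀‖ ≤ R := by simpa using hz₀
    have hC0 : 0 ≤ 2 * K / ε ^ 2 := by positivity
    simp only
    rcases (hV.nonneg z₀).eq_or_lt with h0 | h0
    · rw [← h0, zero_mul]; positivity
    rcases hz₀R.eq_or_lt with h1 | h1
    · rw [h1, sub_self, Real.zero_rpow hN0.ne', mul_zero]; positivity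
    set d := R - ‖z₀‖ with hd
    have hd0 : 0 < d := sub_pos.2 h1
    have hd1 : d ≤ 1 := by linarith [norm_nonneg z₀]
    have hεd : ε * d < d := by nlinarith
    have h1ε : 0 < 1 - ε := sub_pos.2 hε1
    -- On this disc `R - ‖w‖ ≥ (1 - ε) * d`, so maximality gives `V w ≤ (1 - ε) ^ (-N) * V z₀`.
    have hT : ∀ w ∈ Metric.closedBall z₀ (ε * d), V w ≤ 2 * V z₀ := by
      intro w hw
      have h3 := mem_closedBall_iff_norm.1 hw
      have h4 := norm_le_norm_add_norm_sub' w z₀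
      have h5 : d * (1 - ε) ≤ R - ‖w‖ := by linarith
      have h6 : V w * (R - ‖w‖) ^ N ≤ V z₀ * d ^ N :=
        hmax (show w ∈ Metric.closedBall (0 : ℂ) R by simp; nlinarith)
      have h7 : d ^ N * (1 - ε) ^ N ≤ (R - ‖w‖) ^ N := by
        rw [← Real.mul_rpow hd0.le h1ε.le]
        gcongr
      have hdN : 0 < d ^ N := Real.rpow_pos_of_pos hd0 N
      have h8 : V w * (d ^ N * (1 / 2)) ≤ V z₀ * d ^ N :=
        (mul_le_mul_of_nonneg_left ((mul_le_mul_of_nonneg_left hεN hdN.le).trans h7)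
          (hV.nonneg w)).trans h6
      have h9 : d ^ N * V w ≤ d ^ N * (2 * V z₀) := by linarith
      exact le_of_mul_le_mul_left h9 hdN
    have hmain := hV.mul_sq_le hB hp1 hK hKint (T := 2 * V z₀) (δ := ε * d) (z := z₀)
      (by positivity) (by linarith) hT (by
        have : ε * d * B * (2 * V z₀) = (ε * B) * d * (2 * V z₀) := by ring
        rw [this]
        have h3 := Real.pi_gt_three
        have h2 : (ε * B) * d ≤ 1 := mul_le_one₀ hεB hd0.le hd1
        nlinarith)
    have hdN : (d ^ N) ^ p = d ^ 2 := by
      rw [← Real.rpow_mul hd0.le, hNp]; norm_cast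
    have hVp : V z₀ = V z₀ ^ (1 - p) * V z₀ ^ p := by
      rw [← Real.rpow_add h0, sub_add_cancel, Real.rpow_one]
    have h2p : (2 : ℝ) ^ (1 - p) ≤ 2 := by
      conv_rhs => rw [← Real.rpow_one 2]
      exact Real.rpow_le_rpow_of_exponent_le (by norm_num) (by linarith)
    rw [Real.mul_rpow zero_le_two h0.le] at hmain
    nth_rewrite 1 [hVp] at hmain
    have hVq : 0 < V z₀ ^ (1 - p) := Real.rpow_pos_of_pos h0 _
    have hVp0 : 0 < V z₀ ^ p := Real.rpow_pos_of_pos h0 _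
    -- The factor `V z₀ ^ (1 - p)` occurs on both sides of `hmain` and cancels, which leaves the
    -- `p`-th power of the maximum.
    have h10 : V z₀ ^ p * d ^ 2 ≤ 2 * K / ε ^ 2 := by
      rw [le_div_iff₀ (by positivity)]
      refine le_of_mul_le_mul_left ?_ hVq
      have h11 : 2 ^ (1 - p) * V z₀ ^ (1 - p) * K ≤ 2 * V z₀ ^ (1 - p) * K := by gcongr
      have h12 : 2 * (V z₀ ^ (1 - p) * V z₀ ^ p * (d ^ 2 * ε ^ 2)) ≤
          Real.pi * (V z₀ ^ (1 - p) * V z₀ ^ p * (d ^ 2 * ε ^ 2)) := by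
        gcongr
        exact Real.two_le_pi
      nlinarith [mul_nonneg (mul_nonneg hVq.le hVp0.le) (sq_nonneg (d * ε))]
    calc V z₀ * d ^ N = ((V z₀ * d ^ N) ^ p) ^ (1 / p) := by
          rw [← Real.rpow_mul (by positivity), mul_one_div_cancel hp0.ne', Real.rpow_one]
      _ ≤ _ := by
          rw [Real.mul_rpow h0.le (by positivity), hdN]
          gcongr
  refine ⟨⌈N⌉₊, 2 ^ N * (2 * K / ε ^ 2) ^ (1 / p), by positivity, fun z hz => ?_⟩
  have hz1 : ‖z‖ < 1 := by simpa [unitDisk] using hz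
  -- For this `R` the distance `R - ‖z‖` is half of `1 - ‖z‖`.
  have h1 := key ((1 + ‖z‖) / 2) (by positivity) (by linarith) z (by simp; linarith)
  have h2 : (1 - ‖z‖) ^ ⌈N⌉₊ ≤ 2 ^ N * ((1 + ‖z‖) / 2 - ‖z‖) ^ N := by
    rw [← Real.mul_rpow zero_le_two (by linarith), ← Real.rpow_natCast]
    have : 2 * ((1 + ‖z‖) / 2 - ‖z‖) = 1 - ‖z‖ := by ring
    rw [this]
    exact Real.rpow_le_rpow_of_exponent_ge (by linarith) (by linarith [norm_nonneg z])
      (Nat.le_ceil N)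
  calc V z * (1 - ‖z‖) ^ ⌈N⌉₊ ≤ V z * (2 ^ N * ((1 + ‖z‖) / 2 - ‖z‖) ^ N) :=
        mul_le_mul_of_nonneg_left h2 (hV.nonneg z)
    _ = 2 ^ N * (V z * ((1 + ‖z‖) / 2 - ‖z‖) ^ N) := by ring
    _ ≤ _ := by gcongr

end Growth

/-! ### Growth of solutions of ∂̄-systems -/

section System

open Complex MeasureTheory Set Filter Topology

/-- A solution in the unit disk of a first order system `∂G_k/∂z̄ = ∑ⱼ a_{kj} G_j` with coefficients
that are smooth up to the boundary. -/
structure IsDbarSystem {ι : Type*} [Fintype ι] (a : ι → ι → ℂ → ℂ) (G : ι → ℂ → ℂ) : Prop where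
  smooth : ∀ k j, ContDiffOn ℝ ∞ (a k j) (Metric.closedBall 0 1)
  differentiableOn : ∀ k, DifferentiableOn ℝ (G k) unitDisk
  dbar_eq : ∀ k, ∀ z ∈ unitDisk, dbar (G k) z = ∑ j, a k j z * G j z

lemma unitDisk_subset_closedBall : unitDisk ⊆ Metric.closedBall 0 1 := Metric.ball_subset_closedBall

lemma ContinuousOn.exists_bound_unitDisk {g : ℂ → ℂ} (hg : ContinuousOn g (Metric.closedBall 0 1)) :
    ∃ C, 0 ≤ C ∧ ∀ z ∈ unitDisk, ‖g z‖ ≤ C := by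
  obtain ⟨C, hC⟩ := (isCompact_closedBall (0 : ℂ) 1).exists_bound_of_continuousOn hg
  exact ⟨C, (norm_nonneg _).trans (hC 0 (by simp)), fun z hz => hC z (unitDisk_subset_closedBall hz)⟩

variable {ι : Type*} [Fintype ι] {a : ι → ι → ℂ → ℂ} {G : ι → ℂ → ℂ}

lemma IsDbarSystem.continuousOn_dbar (h : IsDbarSystem a G) (k : ι) :
    ContinuousOn (dbar (G k)) unitDisk := by
  refine ContinuousOn.congr ?_ (h.dbar_eq k)
  exact continuousOn_finsetSum _ fun j _ =>
    ((h.smooth k j).continuousOn.mono unitDisk_subset_closedBall).mul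
      (h.differentiableOn j).continuousOn

lemma IsDbarSystem.exists_norm_dbar_le (h : IsDbarSystem a G) :
    ∃ B, 0 ≤ B ∧ ∀ k, ∀ z ∈ unitDisk, ‖dbar (G k) z‖ ≤ B * ∑ j, ‖G j z‖ := by
  choose C hC0 hC using fun k j => (h.smooth k j).continuousOn.exists_bound_unitDisk
  refine ⟨∑ k, ∑ j, C k j, Finset.sum_nonneg fun k _ => Finset.sum_nonneg fun j _ => hC0 k j,
    fun k z hz => ?_⟩
  rw [h.dbar_eq k z hz, Finset.mul_sum]
  refine (norm_sum_le _ _).trans (Finset.sum_le_sum fun j _ => ?_)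
  rw [norm_mul]
  refine mul_le_mul_of_nonneg_right ((hC k j z hz).trans ?_) (norm_nonneg _)
  exact (Finset.single_le_sum (fun j _ => hC0 k j) (Finset.mem_univ j)).trans
    (Finset.single_le_sum (f := fun k => ∑ j, C k j)
      (fun k _ => Finset.sum_nonneg fun j _ => hC0 k j) (Finset.mem_univ k))

/-- Each `G k` has its Wirtinger derivative bounded by a multiple of the whole sum. A single
component need not satisfy such a bound, hence the sum over `k`. -/
theorem IsDbarSystem.isApproxSubmean (h : IsDbarSystem a G) :
    ∃ B, 0 ≤ B ∧ IsApproxSubmean B fun z => ∑ k, ‖G k z‖ := by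
  obtain ⟨B, hB, hle⟩ := h.exists_norm_dbar_le
  refine ⟨Fintype.card ι * (4 * Real.pi * B), by positivity,
    fun z => Finset.sum_nonneg fun k _ => norm_nonneg _,
    continuousOn_finsetSum _ fun k _ => (h.differentiableOn k).continuousOn.norm, ?_⟩
  intro z ρ T hρ hz hT
  have hsub := closedBall_subset_unitDisk hz
  have hball : Metric.ball z (1 - ‖z‖) ⊆ unitDisk := by
    intro w hw
    have h1 := mem_ball_iff_norm.1 hw
    have h2 := norm_le_norm_add_norm_sub' w z
    simp only [unitDisk, mem_ball_zero_iff]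
    linarith
  have h1 : ∀ k, 2 * Real.pi * ‖G k z‖ ≤
      (∫ θ in (0 : ℝ)..(2 * Real.pi), ‖G k (circleMap z ρ θ)‖) + 4 * Real.pi * ρ * (B * T) :=
    fun k => norm_le_circle_average_add ((h.differentiableOn k).mono hball)
      ((h.continuousOn_dbar k).mono hball) hρ (by linarith) fun w hw =>
        (hle k w (hsub hw)).trans (mul_le_mul_of_nonneg_left (hT w hw) hB)
  rw [intervalIntegral.integral_finsetSum, Finset.mul_sum]
  · refine (Finset.sum_le_sum fun k _ => h1 k).trans_eq ?_
    rw [Finset.sum_add_distrib, Finset.sum_const, Finset.card_univ, nsmul_eq_mul]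
    ring
  · intro k _
    refine Continuous.intervalIntegrable (Continuous.norm ?_) _ _
    refine (h.differentiableOn k).continuousOn.comp_continuous (continuous_circleMap z ρ)
      fun θ => hsub (circleMap_mem_closedBall z hρ.le θ)

lemma ENNReal.rpow_sum_le_sum_rpow {κ : Type*} (s : Finset κ) (f : κ → ENNReal) {p : ℝ}
    (hp0 : 0 < p) (hp1 : p ≤ 1) : (∑ k ∈ s, f k) ^ p ≤ ∑ k ∈ s, f k ^ p := by
  classical
  induction s using Finset.induction_on with
  | empty => simp [hp0]
  | insert k s hk ih =>
    rw [Finset.sum_insert hk, Finset.sum_insert hk]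
    exact (ENNReal.rpow_add_le_add_rpow _ _ hp0.le hp1).trans (by gcongr)

lemma lintegral_unitDisk_rpow_lt_top {p : ℝ} {g : ℂ → ℂ} (hg : ContinuousOn g unitDisk)
    (hsup : (⨆ r ∈ Ioo (0 : ℝ) 1,
      ∫⁻ θ in Ioc 0 (2 * Real.pi), ‖g (circleMap 0 r θ)‖ₑ ^ p) < ⊤) :
    ∫⁻ w in unitDisk, ‖g w‖ₑ ^ p < ⊤ := by
  set K := ⨆ r ∈ Ioo (0 : ℝ) 1, ∫⁻ θ in Ioc 0 (2 * Real.pi), ‖g (circleMap 0 r θ)‖ₑ ^ p with hK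
  have hD : MeasurableSet unitDisk := measurableSet_ball
  have hmeas : Measurable (unitDisk.indicator fun w => ‖g w‖ₑ ^ p) := by
    classical
    have h1 : unitDisk.indicator (fun w => ‖g w‖ₑ ^ p) =
        fun w => unitDisk.indicator (fun _ => 1) w * ‖unitDisk.piecewise g (fun _ => 0) w‖ₑ ^ p := by
      funext w; by_cases hw : w ∈ unitDisk <;> simp [hw]
    rw [h1]
    refine (measurable_const.indicator hD).mul ((Measurable.enorm ?_).pow_const p)
    exact hg.measurable_piecewise continuousOn_const hD
  rw [← lintegral_indicator hD, lintegral_eq_lintegral_circleMap 0 hmeas]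
  have hzero : ∀ ρ ∈ Ioi (0 : ℝ), ENNReal.ofReal ρ * ∫⁻ θ in Ioc (0 : ℝ) (2 * Real.pi),
      unitDisk.indicator (fun w => ‖g w‖ₑ ^ p) (circleMap 0 ρ θ) ≤
      (Ioo (0 : ℝ) 1).indicator (fun ρ => ENNReal.ofReal ρ * K) ρ := by
    intro ρ hρ
    by_cases h1 : ρ < 1
    · have hmem : ρ ∈ Ioo (0 : ℝ) 1 := ⟨hρ, h1⟩
      rw [indicator_of_mem hmem]
      refine mul_le_mul_right ?_ _
      refine le_trans (lintegral_mono fun θ => indicator_le_self _ _ _) ?_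
      exact le_iSup₂ (f := fun r (_ : r ∈ Ioo (0 : ℝ) 1) =>
        ∫⁻ θ in Ioc 0 (2 * Real.pi), ‖g (circleMap 0 r θ)‖ₑ ^ p) ρ hmem
    · have h2 : ∀ θ, circleMap 0 ρ θ ∉ unitDisk := fun θ => by
        simp only [unitDisk, mem_ball_zero_iff, norm_circleMap_zero, not_lt]
        exact (not_lt.1 h1).trans (le_abs_self ρ)
      simp [h2]
  refine (setLIntegral_mono' measurableSet_Ioi hzero).trans_lt ?_
  rw [lintegral_indicator measurableSet_Ioo, Measure.restrict_restrict measurableSet_Ioo,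
    inter_eq_left.2 Ioo_subset_Ioi_self, lintegral_mul_const _ (by fun_prop),
    lintegral_Ioo_ofReal zero_le_one]
  exact ENNReal.mul_lt_top ENNReal.ofReal_lt_top hsup

/-- Subadditivity of `t ^ p` for `p ≤ 1` and integration over the radii turn the Hardy bounds into
integrability of the `p`-th power of `∑ ‖G k‖` over the disk. -/
theorem IsDbarSystem.exists_growth (h : IsDbarSystem a G) {p : ℝ} (hp0 : 0 < p) (hp1 : p ≤ 1)
    (hsup : ∀ k, (⨆ r ∈ Ioo (0 : ℝ) 1,
      ∫⁻ θ in Ioc 0 (2 * Real.pi), ‖G k (circleMap 0 r θ)‖ₑ ^ p) < ⊤) :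
    ∃ (m : ℕ) (C : ℝ), 0 ≤ C ∧ ∀ k, ∀ z ∈ unitDisk, ‖G k z‖ * (1 - ‖z‖) ^ m ≤ C := by
  obtain ⟨B, hB, hV⟩ := h.isApproxSubmean
  obtain ⟨m, C, hC, hle⟩ := hV.exists_growth hB hp0 hp1 (by
    have hD : MeasurableSet unitDisk := measurableSet_ball
    calc _ ≤ ∫⁻ w in unitDisk, ∑ k, ‖G k w‖ₑ ^ p := by
          refine lintegral_mono fun w => ?_
          rw [← ENNReal.ofReal_rpow_of_nonneg (Finset.sum_nonneg fun k _ => norm_nonneg _) hp0.le,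
            ENNReal.ofReal_sum_of_nonneg fun k _ => norm_nonneg _]
          simp only [ofReal_norm]
          exact ENNReal.rpow_sum_le_sum_rpow _ _ hp0 hp1
      _ = ∑ k, ∫⁻ w in unitDisk, ‖G k w‖ₑ ^ p :=
          lintegral_finsetSum' _ fun k _ =>
            (((h.differentiableOn k).continuousOn.aestronglyMeasurable hD).enorm.pow_const p)
      _ < ⊤ := ENNReal.sum_lt_top.2 fun k _ =>
          lintegral_unitDisk_rpow_lt_top (h.differentiableOn k).continuousOn (hsup k))
  refine ⟨m, C, hC, fun k z hz => le_trans ?_ (hle z hz)⟩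
  have hz1 : ‖z‖ < 1 := by simpa [unitDisk] using hz
  refine mul_le_mul_of_nonneg_right ?_ (pow_nonneg (by linarith) m)
  exact Finset.single_le_sum (f := fun k => ‖G k z‖) (fun k _ => norm_nonneg _) (Finset.mem_univ k)

end System

/-! ### Gaining powers of the distance to the boundary -/

section BoundaryValue

open Complex MeasureTheory Set Filter Topology

/-- The integrals of `H` against test functions over the circles of radius `e ^ s` are bounded by
`(-s) ^ (-σ)`, uniformly for test functions that are bounded in some `C^N` norm. -/
def HasGrowthBound (H : ℂ → ℂ) (σ : ℝ) : Prop :=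
  ∃ (N : ℕ) (C : ℝ), 0 ≤ C ∧ ∀ φ ∈ circleTest, ∀ M : ℝ,
    (∀ j ≤ N, ∀ θ : ℝ, ‖iteratedDeriv j φ θ‖ ≤ M) →
      ∀ s ∈ Ico (-1 : ℝ) 0, ‖circlePairing 0 H φ s‖ ≤ C * M * (-s) ^ (-σ)

lemma deriv_mem_circleTest {φ : ℝ → ℂ} (hφ : φ ∈ circleTest) : deriv φ ∈ circleTest := by
  refine ⟨(contDiff_infty_iff_deriv.1 hφ.1).2, fun θ => ?_⟩
  have h1 : (fun x => φ (x + 2 * Real.pi)) = φ := funext hφ.2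
  conv_rhs => rw [← h1]
  rw [deriv_comp_add_const]

lemma exp_add_mul_I_mem_unitDisk {s : ℝ} (hs : s < 0) (θ : ℝ) :
    (0 : ℂ) + exp (s + θ * I) ∈ unitDisk := by
  simpa [unitDisk, norm_exp_add_mul_I] using hs

lemma circlePairing_congr {H₁ H₂ : ℂ → ℂ} (h : ∀ z ∈ unitDisk, H₁ z = H₂ z) (φ : ℝ → ℂ) {s : ℝ}
    (hs : s < 0) : circlePairing 0 H₁ φ s = circlePairing 0 H₂ φ s := by
  refine intervalIntegral.integral_congr fun θ _ => ?_
  simp only [h _ (exp_add_mul_I_mem_unitDisk hs θ)]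

lemma HasGrowthBound.congr {H₁ H₂ : ℂ → ℂ} {σ : ℝ} (h : HasGrowthBound H₁ σ)
    (heq : ∀ z ∈ unitDisk, H₂ z = H₁ z) : HasGrowthBound H₂ σ := by
  obtain ⟨N, C, hC, hle⟩ := h
  refine ⟨N, C, hC, fun φ hφ M hM s hs => ?_⟩
  rw [circlePairing_congr heq φ hs.2]
  exact hle φ hφ M hM s hs

lemma HasGrowthBound.add {H₁ H₂ : ℂ → ℂ} {σ : ℝ} (h₁ : HasGrowthBound H₁ σ)
    (h₂ : HasGrowthBound H₂ σ) (hc₁ : ContinuousOn H₁ unitDisk) (hc₂ : ContinuousOn H₂ unitDisk) :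
    HasGrowthBound (fun z => H₁ z + H₂ z) σ := by
  obtain ⟨N₁, C₁, hC₁, hle₁⟩ := h₁
  obtain ⟨N₂, C₂, hC₂, hle₂⟩ := h₂
  refine ⟨max N₁ N₂, C₁ + C₂, by positivity, fun φ hφ M hM s hs => ?_⟩
  have hs1 : Real.exp s < 1 := by simpa using hs.2
  have h1 : circlePairing 0 (fun z => H₁ z + H₂ z) φ s =
      circlePairing 0 H₁ φ s + circlePairing 0 H₂ φ s := by
    simp only [circlePairing, add_mul]
    exact intervalIntegral.integral_add
      ((circlePairing_integrand_continuous hc₁ hφ.1.continuous hs1).intervalIntegrable _ _)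
      ((circlePairing_integrand_continuous hc₂ hφ.1.continuous hs1).intervalIntegrable _ _)
  rw [h1]
  refine (norm_add_le _ _).trans ?_
  rw [add_mul, add_mul]
  exact add_le_add (hle₁ φ hφ M (fun j hj => hM j (hj.trans (le_max_left _ _))) s hs)
    (hle₂ φ hφ M (fun j hj => hM j (hj.trans (le_max_right _ _))) s hs)

lemma HasGrowthBound.sum {κ : Type*} (t : Finset κ) {H : κ → ℂ → ℂ} {σ : ℝ}
    (h : ∀ k, HasGrowthBound (H k) σ) (hc : ∀ k, ContinuousOn (H k) unitDisk) :
    HasGrowthBound (fun z => ∑ k ∈ t, H k z) σ := by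
  classical
  induction t using Finset.induction_on with
  | empty =>
    refine ⟨0, 0, le_rfl, fun φ _ M _ s _ => ?_⟩
    simp [circlePairing]
  | insert k t hk ih =>
    simp only [Finset.sum_insert hk]
    exact (h k).add ih (hc k) (continuousOn_finsetSum _ fun k _ => hc k)

lemma integral_neg_rpow {σ s s' : ℝ} (hσ : σ ≠ 0) (hss : s ≤ s') (hs' : s' < 0) :
    ∫ t in s..s', (-t) ^ (-(σ + 1)) = ((-s') ^ (-σ) - (-s) ^ (-σ)) / σ := by
  rw [intervalIntegral.integral_comp_neg fun t : ℝ => t ^ (-(σ + 1)), integral_rpow]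
  · have h1 : -(σ + 1) + 1 = -σ := by ring
    rw [h1, div_neg, ← neg_div, neg_sub]
  · refine Or.inr ⟨fun h => hσ (by linarith), fun h => ?_⟩
    rw [uIcc_of_le (by linarith)] at h
    linarith [h.1]

/-- Green's formula bounds the `s`-derivative of the pairing by a multiple of `(-s) ^ (-(σ + 1))`,
which is then integrated. Both signs of `σ` matter: positive for the descent, negative for
convergence at the boundary. -/
theorem HasGrowthBound.exists_norm_sub_le {H : ℂ → ℂ} {σ : ℝ} (hσ : σ ≠ 0)
    (hH : DifferentiableOn ℝ H unitDisk) (hH' : ContinuousOn (dbar H) unitDisk)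
    (h : HasGrowthBound H (σ + 1))
    (h' : HasGrowthBound (fun w => starRingEnd ℂ w * dbar H w) (σ + 1)) :
    ∃ (N : ℕ) (C : ℝ), 0 ≤ C ∧ ∀ φ ∈ circleTest, ∀ M : ℝ,
      (∀ j ≤ N, ∀ θ : ℝ, ‖iteratedDeriv j φ θ‖ ≤ M) →
        ∀ s s' : ℝ, -1 ≤ s → s ≤ s' → s' < 0 →
          ‖circlePairing 0 H φ s' - circlePairing 0 H φ s‖ ≤
            C * M * (((-s') ^ (-σ) - (-s) ^ (-σ)) / σ) := by
  obtain ⟨N₁, C₁, hC₁, hle₁⟩ := h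
  obtain ⟨N₂, C₂, hC₂, hle₂⟩ := h'
  -- The extra derivative pays for the term with `deriv φ`.
  refine ⟨max (N₁ + 1) N₂, 2 * C₂ + C₁, by positivity, fun φ hφ M hM s s' hs hss hs' => ?_⟩
  rw [circlePairing_sub (R := 1) hH hH' (hφ.1.of_le (by norm_cast)) hφ.2 hss
    (by simpa using hs'), ← integral_neg_rpow hσ hss hs', ← intervalIntegral.integral_const_mul]
  refine intervalIntegral.norm_integral_le_of_norm_le hss (ae_of_all _ fun t ht => ?_) ?_
  · have ht' : t ∈ Ico (-1 : ℝ) 0 := ⟨hs.trans ht.1.le, ht.2.trans_lt hs'⟩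
    have e1 := hle₁ _ (deriv_mem_circleTest hφ) M (fun j hj θ => by
      rw [← iteratedDeriv_succ']
      exact hM _ ((Nat.add_le_add_right hj 1).trans (le_max_left _ _)) θ) t ht'
    have e2 := hle₂ φ hφ M (fun j hj => hM j (hj.trans (le_max_right _ _))) t ht'
    simp only [sub_zero]
    refine (norm_add_le _ _).trans ?_
    rw [norm_mul, norm_mul, norm_I, Complex.norm_ofNat]
    linarith
  · refine ContinuousOn.intervalIntegrable ?_
    refine continuousOn_const.mul (ContinuousOn.rpow_const (by fun_prop) fun t ht => Or.inl ?_)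
    rw [uIcc_of_le hss] at ht
    linarith [ht.2]

/-- Compare `s` with the fixed base point `-1`, where `(-s) ^ (-σ) = 1`. -/
theorem HasGrowthBound.improve {H : ℂ → ℂ} {σ : ℝ} (hσ : 0 < σ)
    (hH : DifferentiableOn ℝ H unitDisk) (hH' : ContinuousOn (dbar H) unitDisk)
    (h : HasGrowthBound H (σ + 1))
    (h' : HasGrowthBound (fun w => starRingEnd ℂ w * dbar H w) (σ + 1)) :
    HasGrowthBound H σ := by
  obtain ⟨N₁, C₁, hC₁, hle₁⟩ := HasGrowthBound.exists_norm_sub_le hσ.ne' hH hH' h h'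
  obtain ⟨N₂, C₂, hC₂, hle₂⟩ := h
  refine ⟨max N₁ N₂, C₁ / σ + C₂, by positivity, fun φ hφ M hM s hs => ?_⟩
  have hM0 : 0 ≤ M := (norm_nonneg _).trans (hM 0 (Nat.zero_le _) 0)
  have e1 := hle₁ φ hφ M (fun j hj => hM j (hj.trans (le_max_left _ _))) (-1) s le_rfl hs.1 hs.2
  have e2 := hle₂ φ hφ M (fun j hj => hM j (hj.trans (le_max_right _ _))) (-1) (by simp)
  have e3 := norm_le_norm_add_norm_sub' (circlePairing 0 H φ s) (circlePairing 0 H φ (-1))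
  have e4 : 1 ≤ (-s) ^ (-σ) :=
    Real.one_le_rpow_of_pos_of_le_one_of_nonpos (by linarith [hs.2]) (by linarith [hs.1])
      (by linarith)
  simp only [neg_neg, Real.one_rpow, mul_one] at e1 e2
  have e5 : C₁ * M * (((-s) ^ (-σ) - 1) / σ) ≤ C₁ / σ * M * (-s) ^ (-σ) := by
    have : C₁ * M * (((-s) ^ (-σ) - 1) / σ) = C₁ / σ * M * ((-s) ^ (-σ) - 1) := by ring
    rw [this]
    gcongr
    linarith
  have e6 : C₂ * M ≤ C₂ * M * (-s) ^ (-σ) := le_mul_of_one_le_right (by positivity) e4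
  linarith

end BoundaryValue

/-! ### Existence of the boundary distribution -/

section BoundaryValue

open Complex MeasureTheory Set Filter Topology

lemma iteratedDeriv_mem_circleTest {φ : ℝ → ℂ} (hφ : φ ∈ circleTest) (j : ℕ) :
    iteratedDeriv j φ ∈ circleTest := by
  induction j with
  | zero => simpa using hφ
  | succ j ih =>
    rw [iteratedDeriv_succ]
    exact deriv_mem_circleTest ih

lemma exists_bound_of_mem_circleTest {φ : ℝ → ℂ} (hφ : φ ∈ circleTest) :
    ∃ M, ∀ θ, ‖φ θ‖ ≤ M := by
  obtain ⟨M, hM⟩ := (isCompact_Icc (a := (0 : ℝ)) (b := 2 * Real.pi)).exists_bound_of_continuousOn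
    hφ.1.continuous.continuousOn
  refine ⟨M, fun θ => ?_⟩
  obtain ⟨y, hy, hθ⟩ := hφ.2.exists_mem_Ico₀ Real.two_pi_pos θ
  rw [hθ]
  exact hM y (Ico_subset_Icc_self hy)

lemma exists_iteratedDeriv_bound {φ : ℝ → ℂ} (hφ : φ ∈ circleTest) (N : ℕ) :
    ∃ M, ∀ j ≤ N, ∀ θ, ‖iteratedDeriv j φ θ‖ ≤ M := by
  choose M hM using fun j => exists_bound_of_mem_circleTest (iteratedDeriv_mem_circleTest hφ j)
  refine ⟨∑ j ∈ Finset.range (N + 1), M j, fun j hj θ => (hM j θ).trans ?_⟩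
  exact Finset.single_le_sum (f := M) (fun i _ => (norm_nonneg _).trans (hM i 0))
    (Finset.mem_range.2 (by omega))

lemma circlePairing_log {H : ℂ → ℂ} {φ : ℝ → ℂ} {r : ℝ} (hr : 0 < r) :
    circlePairing 0 H φ (Real.log r) =
      ∫ θ in (0 : ℝ)..(2 * Real.pi), H (circleMap 0 r θ) * φ θ := by
  simp only [circlePairing, circleMap_eq_exp_log hr]

lemma tendsto_log_left_one : Tendsto Real.log (𝓝[<] 1) (𝓝[<] 0) := by
  refine tendsto_nhdsWithin_iff.2 ⟨?_, ?_⟩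
  · have := (Real.continuousAt_log one_ne_zero).tendsto
    rw [Real.log_one] at this
    exact this.mono_left nhdsWithin_le_nhds
  · filter_upwards [Ioo_mem_nhdsLT (zero_lt_one (α := ℝ))] with r hr
    exact Real.log_neg hr.1 hr.2

/-- With `σ = -1/2` the increments are `O(√(-s))`, so the pairings are Cauchy as `s` tends to `0`
from the left. Comparing the limit with the pairing at `s = -1` gives continuity in `φ`. -/
theorem HasGrowthBound.hasDistributionalBoundaryValue {H : ℂ → ℂ}
    (hH : DifferentiableOn ℝ H unitDisk) (hH' : ContinuousOn (dbar H) unitDisk)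
    (h : HasGrowthBound H (1 / 2))
    (h' : HasGrowthBound (fun w => starRingEnd ℂ w * dbar H w) (1 / 2)) :
    HasDistributionalBoundaryValue H := by
  have hhalf : (1 / 2 : ℝ) = -(1 / 2) + 1 := by norm_num
  have hsub := HasGrowthBound.exists_norm_sub_le (σ := -(1 / 2)) (by norm_num) hH hH'
    (by rwa [← hhalf]) (by rwa [← hhalf])
  obtain ⟨N₁, C₁, hC₁, hle₁⟩ := hsub
  obtain ⟨N₂, C₂, hC₂, hle₂⟩ := h
  have hdiff : ∀ φ ∈ circleTest, ∀ M : ℝ, (∀ j ≤ N₁, ∀ θ : ℝ, ‖iteratedDeriv j φ θ‖ ≤ M) →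
      ∀ s s' : ℝ, -1 ≤ s → s ≤ s' → s' < 0 →
        ‖circlePairing 0 H φ s' - circlePairing 0 H φ s‖ ≤ 2 * C₁ * M * Real.sqrt (-s) := by
    intro φ hφ M hM s s' hs hss hs'
    have hM0 : 0 ≤ M := (norm_nonneg _).trans (hM 0 (Nat.zero_le _) 0)
    refine (hle₁ φ hφ M hM s s' hs hss hs').trans ?_
    rw [neg_neg, ← Real.sqrt_eq_rpow, ← Real.sqrt_eq_rpow]
    have : C₁ * M * ((√(-s') - √(-s)) / -(1 / 2)) =
        2 * C₁ * M * √(-s) - 2 * C₁ * M * √(-s') := by ring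
    rw [this]
    have : 0 ≤ 2 * C₁ * M * √(-s') := by positivity
    linarith
  have hlim : ∀ φ : circleTest, ∃ l : ℂ, Tendsto (circlePairing 0 H φ) (𝓝[<] 0) (𝓝 l) := by
    intro φ
    obtain ⟨M, hM⟩ := exists_iteratedDeriv_bound φ.2 N₁
    rw [← cauchy_map_iff_exists_tendsto, Metric.cauchy_iff]
    refine ⟨inferInstance, fun ε hε => ?_⟩
    have h1 : Tendsto (fun s : ℝ => 2 * C₁ * M * √(-s)) (𝓝[<] 0) (𝓝 (2 * C₁ * M * √(-0))) :=
      (Continuous.tendsto (by fun_prop) 0).mono_left nhdsWithin_le_nhds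
    rw [neg_zero, Real.sqrt_zero, mul_zero] at h1
    obtain ⟨s₀, hs₀, hs₀'⟩ := ((h1.eventually (eventually_lt_nhds (half_pos hε))).and
      (Ioo_mem_nhdsLT (by norm_num : (-1 : ℝ) < 0))).exists
    refine ⟨circlePairing 0 H φ '' Ioo s₀ 0, image_mem_map (Ioo_mem_nhdsLT hs₀'.2), ?_⟩
    rintro _ ⟨s, hs, rfl⟩ _ ⟨t, ht, rfl⟩
    have e1 := hdiff φ φ.2 M hM s₀ s hs₀'.1.le hs.1.le hs.2
    have e2 := hdiff φ φ.2 M hM s₀ t hs₀'.1.le ht.1.le ht.2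
    rw [← dist_eq_norm] at e1 e2
    linarith [dist_triangle_right (circlePairing 0 H φ s) (circlePairing 0 H φ t)
      (circlePairing 0 H φ s₀)]
  choose u hu using hlim
  have hint : ∀ φ : circleTest, ∀ s : ℝ, s < 0 → IntervalIntegrable
      (fun θ : ℝ => H (0 + exp (s + θ * I)) * (φ : ℝ → ℂ) θ) volume 0 (2 * Real.pi) :=
    fun φ s hs => (circlePairing_integrand_continuous hH.continuousOn φ.2.1.continuous
      (by simpa using hs)).intervalIntegrable _ _
  have hneg : ∀ᶠ s : ℝ in 𝓝[<] 0, s < 0 := eventually_mem_nhdsWithin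
  refine ⟨?_, ⟨⟨u, ?_⟩, ?_⟩, ?_, ?_⟩
  · filter_upwards [Ioo_mem_nhdsLT (zero_lt_one (α := ℝ))] with r hr
    refine Continuous.intervalIntegrable ?_ _ _
    refine hH.continuousOn.comp_continuous (continuous_circleMap 0 r) fun θ => ?_
    simpa [unitDisk, abs_of_pos hr.1] using hr.2
  · intro φ ψ
    refine tendsto_nhds_unique (hu (φ + ψ)) (((hu φ).add (hu ψ)).congr' ?_)
    filter_upwards [hneg] with s hs
    simp only [circlePairing]
    rw [← intervalIntegral.integral_add (hint φ s hs) (hint ψ s hs)]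
    refine intervalIntegral.integral_congr fun θ _ => ?_
    simp [mul_add]
  · intro c φ
    refine tendsto_nhds_unique (hu (c • φ)) (((hu φ).const_mul c).congr' ?_)
    filter_upwards with s
    simp only [circlePairing]
    rw [← intervalIntegral.integral_const_mul]
    refine intervalIntegral.integral_congr fun θ _ => ?_
    simp
    ring
  · refine ⟨max N₁ N₂, C₂ + 2 * C₁, fun φ M hM => ?_⟩
    refine le_of_tendsto (hu φ).norm ?_
    filter_upwards [Ioo_mem_nhdsLT (by norm_num : (-1 : ℝ) < 0)] with s hs
    have e1 := hdiff φ φ.2 M (fun j hj => hM j (hj.trans (le_max_left _ _))) (-1) s le_rfl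
      hs.1.le hs.2
    have e2 := hle₂ φ φ.2 M (fun j hj => hM j (hj.trans (le_max_right _ _))) (-1) (by simp)
    have e3 := norm_le_norm_add_norm_sub' (circlePairing 0 H φ s) (circlePairing 0 H φ (-1))
    simp only [neg_neg, Real.one_rpow, Real.sqrt_one, mul_one] at e1 e2
    linarith
  · intro φ
    refine ((hu φ).comp tendsto_log_left_one).congr' ?_
    filter_upwards [Ioo_mem_nhdsLT (zero_lt_one (α := ℝ))] with r hr
    exact circlePairing_log hr.1

lemma neg_half_le_one_sub_exp {s : ℝ} (hs : s ∈ Ico (-1 : ℝ) 0) : -s / 2 ≤ 1 - Real.exp s := by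
  have h1 := Real.add_one_le_exp (-s)
  have h2 : Real.exp (-s) * Real.exp s = 1 := by rw [← Real.exp_add]; simp
  have h3 := Real.exp_pos s
  nlinarith [hs.1, hs.2]

/-- The added `1 / 2` keeps the descent by integers away from the exponent `σ = 0`, where
integration would produce a logarithm. -/
lemma HasGrowthBound.of_norm_mul_pow_le {H : ℂ → ℂ} {m : ℕ} {C : ℝ} (hC : 0 ≤ C)
    (h : ∀ z ∈ unitDisk, ‖H z‖ * (1 - ‖z‖) ^ m ≤ C) : HasGrowthBound H (m + 1 / 2) := by
  refine ⟨0, 2 ^ m * C * (2 * Real.pi), by positivity, fun φ hφ M hM s hs => ?_⟩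
  have hM0 : 0 ≤ M := (norm_nonneg _).trans (hM 0 le_rfl 0)
  have hs0 : 0 < -s := neg_pos.2 hs.2
  have hH : ∀ θ : ℝ, ‖H (0 + exp (s + θ * I))‖ ≤ 2 ^ m * C * (-s) ^ (-(m + 1 / 2) : ℝ) := by
    intro θ
    have h1 := h _ (exp_add_mul_I_mem_unitDisk hs.2 θ)
    rw [zero_add, norm_exp_add_mul_I] at h1
    rw [zero_add]
    have h2 : (-s / 2) ^ m ≤ (1 - Real.exp s) ^ m := by
      have := neg_half_le_one_sub_exp hs
      gcongr
    have h3 : (-s) ^ (-(m : ℝ)) ≤ (-s) ^ (-(m + 1 / 2) : ℝ) :=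
      Real.rpow_le_rpow_of_exponent_ge hs0 (by linarith [hs.1]) (by linarith)
    have h4 : ‖H (exp (s + θ * I))‖ * (-s / 2) ^ m ≤ C :=
      (mul_le_mul_of_nonneg_left h2 (norm_nonneg _)).trans h1
    refine le_trans ?_ (mul_le_mul_of_nonneg_left h3 (by positivity))
    rw [Real.rpow_neg hs0.le, Real.rpow_natCast, ← div_eq_mul_inv, le_div_iff₀ (by positivity)]
    rw [div_pow, mul_div_assoc', div_le_iff₀ (by positivity)] at h4
    linarith
  have h5 := intervalIntegral.norm_integral_le_of_norm_le_const (a := 0) (b := 2 * Real.pi)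
    (f := fun θ : ℝ => H (0 + exp (s + θ * I)) * φ θ)
    (C := 2 ^ m * C * (-s) ^ (-(m + 1 / 2) : ℝ) * M) fun θ _ => by
      rw [norm_mul]
      have := hM 0 le_rfl θ
      rw [iteratedDeriv_zero] at this
      exact mul_le_mul (hH θ) this (norm_nonneg _) (by positivity)
  rw [sub_zero, abs_of_pos Real.two_pi_pos] at h5
  refine h5.trans_eq ?_
  ring

lemma dbar_mul {H g : ℂ → ℂ} {z : ℂ} (hH : DifferentiableAt ℝ H z) (hg : DifferentiableAt ℝ g z) :
    dbar (fun w => H w * g w) z = dbar H z * g z + H z * dbar g z := by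
  simp only [dbar]
  rw [fderiv_fun_mul hH hg]
  simp only [add_apply, smul_apply, smul_eq_mul]
  ring

/-- Wirtinger derivatives of functions that are smooth up to the boundary have the same property. -/
lemma exists_smooth_eq_dbar {g : ℂ → ℂ} (hg : ContDiffOn ℝ ∞ g (Metric.closedBall 0 1)) :
    ∃ g', ContDiffOn ℝ ∞ g' (Metric.closedBall 0 1) ∧ ∀ z ∈ unitDisk, dbar g z = g' z := by
  have hu : UniqueDiffOn ℝ (Metric.closedBall (0 : ℂ) 1) :=
    uniqueDiffOn_convex (convex_closedBall 0 1) (by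
      rw [interior_closedBall _ one_ne_zero]; exact ⟨0, by simp⟩)
  have h1 : ContDiffOn ℝ ∞ (fderivWithin ℝ g (Metric.closedBall 0 1)) (Metric.closedBall 0 1) :=
    hg.fderivWithin hu (by norm_num)
  refine ⟨fun z => (1 / 2 : ℂ) * (fderivWithin ℝ g (Metric.closedBall 0 1) z 1 +
    I * fderivWithin ℝ g (Metric.closedBall 0 1) z I),
    contDiffOn_const.mul ((h1.clm_apply contDiffOn_const).add
      (contDiffOn_const.mul (h1.clm_apply contDiffOn_const))), fun z hz => ?_⟩
  have h2 : Metric.closedBall (0 : ℂ) 1 ∈ 𝓝 z :=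
    mem_of_superset (Metric.isOpen_ball.mem_nhds hz) Metric.ball_subset_closedBall
  simp only [dbar, fderivWithin_of_mem_nhds h2]

lemma isOpen_unitDisk : IsOpen unitDisk := Metric.isOpen_ball

lemma ContDiffOn.differentiableAt_of_mem_unitDisk {g : ℂ → ℂ}
    (hg : ContDiffOn ℝ ∞ g (Metric.closedBall 0 1)) {z : ℂ} (hz : z ∈ unitDisk) :
    DifferentiableAt ℝ g z :=
  (hg.differentiableOn (by simp)).differentiableAt
    (mem_of_superset (isOpen_unitDisk.mem_nhds hz) unitDisk_subset_closedBall)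

variable {ι : Type*} [Fintype ι] {a : ι → ι → ℂ → ℂ} {G : ι → ℂ → ℂ}

lemma IsDbarSystem.differentiableOn_mul (h : IsDbarSystem a G) (k : ι) {g : ℂ → ℂ}
    (hg : ContDiffOn ℝ ∞ g (Metric.closedBall 0 1)) :
    DifferentiableOn ℝ (fun z => G k z * g z) unitDisk :=
  (h.differentiableOn k).mul fun _ hz =>
    (hg.differentiableAt_of_mem_unitDisk hz).differentiableWithinAt

lemma IsDbarSystem.dbar_mul_eq (h : IsDbarSystem a G) (k : ι) {g : ℂ → ℂ}
    (hg : ContDiffOn ℝ ∞ g (Metric.closedBall 0 1)) {z : ℂ} (hz : z ∈ unitDisk) :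
    dbar (fun w => G k w * g w) z = (∑ j, a k j z * G j z) * g z + G k z * dbar g z := by
  rw [dbar_mul ((h.differentiableOn k).differentiableAt (isOpen_unitDisk.mem_nhds hz))
    (hg.differentiableAt_of_mem_unitDisk hz), h.dbar_eq k z hz]

lemma IsDbarSystem.continuousOn_dbar_mul (h : IsDbarSystem a G) (k : ι) {g : ℂ → ℂ}
    (hg : ContDiffOn ℝ ∞ g (Metric.closedBall 0 1)) :
    ContinuousOn (dbar fun z => G k z * g z) unitDisk := by
  obtain ⟨g', hg', hgeq⟩ := exists_smooth_eq_dbar hg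
  have hG := fun j => (h.differentiableOn j).continuousOn
  have ha := fun j => (h.smooth k j).continuousOn.mono unitDisk_subset_closedBall
  have h1 := hg.continuousOn.mono unitDisk_subset_closedBall
  have h2 := hg'.continuousOn.mono unitDisk_subset_closedBall
  refine ContinuousOn.congr (f := fun z => (∑ j, a k j z * G j z) * g z + G k z * g' z) ?_
    fun z hz => by rw [h.dbar_mul_eq k hg hz, hgeq z hz]
  exact ((continuousOn_finsetSum _ fun j _ => (ha j).mul (hG j)).mul h1).add ((hG k).mul h2)

/-- By the product rule the function is a sum of terms `G j` times a function smooth up to the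
boundary. This closure is why growth bounds are carried for all multipliers `g` at once. -/
lemma IsDbarSystem.hasGrowthBound_conj_mul_dbar (h : IsDbarSystem a G) {σ : ℝ}
    (hσ : ∀ k g, ContDiffOn ℝ ∞ g (Metric.closedBall 0 1) → HasGrowthBound (fun z => G k z * g z) σ)
    (k : ι) {g : ℂ → ℂ} (hg : ContDiffOn ℝ ∞ g (Metric.closedBall 0 1)) :
    HasGrowthBound (fun w => starRingEnd ℂ w * dbar (fun z => G k z * g z) w) σ := by
  obtain ⟨g', hg', hgeq⟩ := exists_smooth_eq_dbar hg
  have hconj : ContDiffOn ℝ ∞ (fun z : ℂ => starRingEnd ℂ z) (Metric.closedBall 0 1) :=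
    Complex.conjCLE.contDiff.contDiffOn
  have h1 := fun j => (hconj.mul (h.smooth k j)).mul hg
  have h2 := hconj.mul hg'
  refine ((HasGrowthBound.sum Finset.univ (fun j => hσ j _ (h1 j)) fun j =>
    (h.differentiableOn_mul j (h1 j)).continuousOn).add (hσ k _ h2)
      (continuousOn_finsetSum _ fun j _ => (h.differentiableOn_mul j (h1 j)).continuousOn)
      (h.differentiableOn_mul k h2).continuousOn).congr fun z hz => ?_
  rw [h.dbar_mul_eq k hg hz, hgeq z hz, mul_add, Finset.sum_mul, Finset.mul_sum]
  congr 1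
  · exact Finset.sum_congr rfl fun j _ => by ring
  · ring

/-- Solutions of smooth `∂/∂z̄`-systems in the disk with Hardy-type bounds have boundary values in
the sense of distributions. -/
theorem IsDbarSystem.hasDistributionalBoundaryValue (h : IsDbarSystem a G) {p : ℝ} (hp0 : 0 < p)
    (hp1 : p ≤ 1)
    (hsup : ∀ k, (⨆ r ∈ Ioo (0 : ℝ) 1,
      ∫⁻ θ in Ioc 0 (2 * Real.pi), ‖G k (circleMap 0 r θ)‖ₑ ^ p) < ⊤) (k : ι) :
    HasDistributionalBoundaryValue (G k) := by
  obtain ⟨m, C, hC, hle⟩ := h.exists_growth hp0 hp1 hsup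
  have hstart : ∀ k g, ContDiffOn ℝ ∞ g (Metric.closedBall 0 1) →
      HasGrowthBound (fun z => G k z * g z) (m + 1 / 2) := by
    intro k g hg
    obtain ⟨D, hD, hgD⟩ := hg.continuousOn.exists_bound_unitDisk
    refine HasGrowthBound.of_norm_mul_pow_le (C := C * D) (by positivity) fun z hz => ?_
    calc _ = (‖G k z‖ * (1 - ‖z‖) ^ m) * ‖g z‖ := by rw [norm_mul]; ring
      _ ≤ _ := mul_le_mul (hle k z hz) (hgD z hz) (norm_nonneg _) hC
  have hdown : ∀ k g, ContDiffOn ℝ ∞ g (Metric.closedBall 0 1) →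
      HasGrowthBound (fun z => G k z * g z) (1 / 2) := by
    -- The pointwise bound is tied to the original `m`; the induction lowers the exponent in
    -- `hstart` alone.
    clear hle
    induction m with
    | zero => simpa using hstart
    | succ m ih =>
      refine ih fun k g hg => ?_
      have hm : ((m + 1 : ℕ) : ℝ) + 1 / 2 = (m + 1 / 2) + 1 := by push_cast; ring
      rw [hm] at hstart
      exact HasGrowthBound.improve (by positivity) (h.differentiableOn_mul k hg)
        (h.continuousOn_dbar_mul k hg) (hstart k g hg) (h.hasGrowthBound_conj_mul_dbar hstart k hg)
  have hone : ContDiffOn ℝ ∞ (fun _ : ℂ => (1 : ℂ)) (Metric.closedBall 0 1) := contDiffOn_const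
  have h1 := hdown k _ hone
  have h2 := h.hasGrowthBound_conj_mul_dbar hdown k hone
  simp only [mul_one] at h1 h2
  exact h1.hasDistributionalBoundaryValue (h.differentiableOn k) (h.continuousOn_dbar k) h2

end BoundaryValue

/-! ### Reduction of the meta-analytic equation to a system -/

section MetaAnalytic

open MeasureTheory Set Filter Topology

lemma dbar_congr {g₁ g₂ : ℂ → ℂ} (h : ∀ z ∈ unitDisk, g₁ z = g₂ z) {z : ℂ} (hz : z ∈ unitDisk) :
    dbar g₁ z = dbar g₂ z := by
  have h1 : g₁ =ᶠ[𝓝 z] g₂ := by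
    filter_upwards [isOpen_unitDisk.mem_nhds hz] with w hw using h w hw
  simp only [dbar, h1.fderiv_eq]

lemma dbar_add {g₁ g₂ : ℂ → ℂ} {z : ℂ} (h₁ : DifferentiableAt ℝ g₁ z)
    (h₂ : DifferentiableAt ℝ g₂ z) : dbar (fun w => g₁ w + g₂ w) z = dbar g₁ z + dbar g₂ z := by
  simp only [dbar, fderiv_fun_add h₁ h₂, add_apply]
  ring

lemma dbar_sum {κ : Type*} (t : Finset κ) {g : κ → ℂ → ℂ} {z : ℂ}
    (h : ∀ k ∈ t, DifferentiableAt ℝ (g k) z) :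
    dbar (fun w => ∑ k ∈ t, g k w) z = ∑ k ∈ t, dbar (g k) z := by
  simp only [dbar, fderiv_fun_sum h, sum_apply, Finset.mul_sum, ← Finset.sum_add_distrib]

/-- The iterates of `∂/∂z̄ - A` are combinations of the iterates of `∂/∂z̄` with leading coefficient
`1`, and the latter are differentiable as long as the former are. -/
theorem IsMetaAnalytic.exists_expansion {n : ℕ} {A f : ℂ → ℂ} (hf : IsMetaAnalytic n A f)
    (hA : ContDiffOn ℝ ∞ A (Metric.closedBall 0 1)) (k : ℕ) (hk : k ≤ n) :
    (∀ i < k, DifferentiableOn ℝ (dbar^[i] f) unitDisk) ∧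
      ∃ d : ℕ → ℂ → ℂ, (∀ j, ContDiffOn ℝ ∞ (d j) (Metric.closedBall 0 1)) ∧
        ∀ z ∈ unitDisk, (metaOp A)^[k] f z =
          dbar^[k] f z + ∑ j ∈ Finset.range k, d j z * dbar^[j] f z := by
  induction k with
  | zero => exact ⟨by simp, fun _ _ => 0, fun _ => contDiffOn_const, by simp⟩
  | succ k ih =>
    obtain ⟨hdiff, d, hd, hdeq⟩ := ih (by omega)
    choose d' hd' hdeq' using fun j => exists_smooth_eq_dbar (hd j)
    have hterm : ∀ j ∈ Finset.range k, ∀ z ∈ unitDisk,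
        DifferentiableAt ℝ (fun w => d j w * dbar^[j] f w) z := fun j hj z hz =>
      ((hd j).differentiableAt_of_mem_unitDisk hz).mul
        ((hdiff j (Finset.mem_range.1 hj)).differentiableAt (isOpen_unitDisk.mem_nhds hz))
    have hsum : ∀ z ∈ unitDisk,
        DifferentiableAt ℝ (fun w => ∑ j ∈ Finset.range k, d j w * dbar^[j] f w) z :=
      fun z hz => DifferentiableAt.fun_sum fun j hj => hterm j hj z hz
    have hGk : DifferentiableOn ℝ (dbar^[k] f) unitDisk := by
      refine DifferentiableOn.congr (f := fun z => (metaOp A)^[k] f z -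
        ∑ j ∈ Finset.range k, d j z * dbar^[j] f z)
        ((hf.1 k (by omega)).sub fun z hz => (hsum z hz).differentiableWithinAt) fun z hz => ?_
      rw [hdeq z hz, add_sub_cancel_right]
    -- Applying `∂/∂z̄ - A` to `d j * dbar^[j] f` puts `d j` at index `j + 1` and `d' j - A * d j`
    -- at index `j`; the leading term contributes `-A` at index `k`.
    refine ⟨fun i hi => ?_, fun j z => (if j = 0 then 0 else d (j - 1) z) +
      (if j < k then d' j z - A z * d j z else -A z), fun j => ?_, fun z hz => ?_⟩
    · rcases Nat.lt_succ_iff_lt_or_eq.1 hi with h | rfl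
      · exact hdiff i h
      · exact hGk
    · refine ContDiffOn.add ?_ ?_
      · split_ifs
        exacts [contDiffOn_const, hd _]
      · split_ifs
        exacts [(hd' j).sub (hA.mul (hd j)), hA.neg]
    · rw [Function.iterate_succ_apply', metaOp, dbar_congr hdeq hz, hdeq z hz,
        dbar_add (hGk.differentiableAt (isOpen_unitDisk.mem_nhds hz)) (hsum z hz),
        dbar_sum _ fun j hj => hterm j hj z hz, ← Function.iterate_succ_apply' dbar]
      have h1 : ∑ j ∈ Finset.range k, dbar (fun w => d j w * dbar^[j] f w) z =
          ∑ j ∈ Finset.range k, (d' j z * dbar^[j] f z + d j z * dbar^[j + 1] f z) := by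
        refine Finset.sum_congr rfl fun j hj => ?_
        rw [dbar_mul ((hd j).differentiableAt_of_mem_unitDisk hz)
          ((hdiff j (Finset.mem_range.1 hj)).differentiableAt (isOpen_unitDisk.mem_nhds hz)),
          hdeq' j z hz, ← Function.iterate_succ_apply' dbar]
      have h2 : ∑ j ∈ Finset.range (k + 1), (if j = 0 then 0 else d (j - 1) z) * dbar^[j] f z =
          ∑ j ∈ Finset.range k, d j z * dbar^[j + 1] f z := by
        rw [Finset.sum_range_succ']
        simp
      have h3 : ∑ j ∈ Finset.range (k + 1),
          (if j < k then d' j z - A z * d j z else -A z) * dbar^[j] f z =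
          ∑ j ∈ Finset.range k, (d' j z - A z * d j z) * dbar^[j] f z - A z * dbar^[k] f z := by
        rw [Finset.sum_range_succ, if_neg (lt_irrefl k), sub_eq_add_neg, neg_mul]
        congr 1
        exact Finset.sum_congr rfl fun j hj => by rw [if_pos (Finset.mem_range.1 hj)]
      simp only [add_mul, Finset.sum_add_distrib]
      rw [h1, h2, h3, Finset.sum_add_distrib]
      simp only [sub_mul, Finset.sum_sub_distrib, mul_add, Finset.mul_sum, mul_assoc]
      ring

/-- The companion system: each derivative is mapped to the next one, and the equation expresses
`dbar^[n] f` through the lower ones. -/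
theorem IsMetaAnalytic.exists_isDbarSystem {n : ℕ} {A f : ℂ → ℂ} (hf : IsMetaAnalytic n A f)
    (hA : ContDiffOn ℝ ∞ A (Metric.closedBall 0 1)) :
    ∃ a : Fin n → Fin n → ℂ → ℂ, IsDbarSystem a fun k => dbar^[k] f := by
  obtain ⟨hdiff, d, hd, hdeq⟩ := hf.exists_expansion hA n le_rfl
  refine ⟨fun k j z => if (k : ℕ) + 1 < n then (if (j : ℕ) = k + 1 then 1 else 0) else -d j z,
    fun k j => ?_, fun k => hdiff k k.2, fun k z hz => ?_⟩
  · split_ifs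
    exacts [contDiffOn_const, contDiffOn_const, (hd j).neg]
  · rw [← Function.iterate_succ_apply' dbar]
    by_cases hk : (k : ℕ) + 1 < n
    · simp only [if_pos hk]
      rw [Finset.sum_eq_single (⟨k + 1, hk⟩ : Fin n)]
      · simp
      · intro j _ hj
        rw [if_neg fun h => hj (Fin.ext h), zero_mul]
      · simp
    · simp only [if_neg hk]
      have hkn : (k : ℕ) + 1 = n := by omega
      have h1 := hdeq z hz
      rw [hf.2 z hz, Finset.sum_range] at h1
      rw [Nat.succ_eq_add_one, hkn]
      simp only [neg_mul, Finset.sum_neg_distrib]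
      exact eq_neg_of_add_eq_zero_left h1.symm

lemma iSup_lintegral_lt_top_of_hardyNorm_lt_top {n : ℕ} {p : ℝ} {f : ℂ → ℂ} (hp : 0 < p)
    (h : hardyNorm n p f < ⊤) {k : ℕ} (hk : k < n) :
    (⨆ r ∈ Ioo (0 : ℝ) 1,
      ∫⁻ θ in Ioc 0 (2 * Real.pi), ‖dbar^[k] f (circleMap 0 r θ)‖ₑ ^ p) < ⊤ :=
  (ENNReal.rpow_lt_top_iff_of_pos (by positivity)).1
    (ENNReal.sum_lt_top.1 h k (Finset.mem_range.2 hk))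

end MetaAnalytic

theorem mainTheorem8 (n : ℕ) (hn : 0 < n) (p : ℝ) (hp0 : 0 < p) (hp1 : p ≤ 1)
    (A : ℂ → ℂ) (hA : ContDiffOn ℝ ∞ A (Metric.closedBall 0 1))
    (f : ℂ → ℂ) (hf : f ∈ MetaHardy n p A) :
    HasDistributionalBoundaryValue f := by
  obtain ⟨a, ha⟩ := hf.1.exists_isDbarSystem hA
  exact ha.hasDistributionalBoundaryValue hp0 hp1
    (fun k => iSup_lintegral_lt_top_of_hardyNorm_lt_top hp0 hf.2 k.2) ⟨0, hn⟩
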